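/- Consider two-armed bandits over a horizon $T\in\mathbb N$. At round $t\in\{1,\dots,T\}$ a learner picks an arm $a_t\in\{1,2\}$ and observes a reward $r_t$ which, given the past and $a_t$, is Gaussian with mean $\mu_t(a_t)$ and variance $1$. A policy $\pi$ is a (possibly randomized) rule that draws $a_t$ according to a conditional law depending only on $a_1,r_1,\dots,a_{t-1},r_{t-1}$; $\Pi$ is the set of all policies. For a threshold $S\in\mathbb R$, the satisficing regret of $\pi$ in the environment $\nu=(\mu_t)_{t\le T}$ is $$R_T^S(\pi;\nu)=\mathbb E_{\pi,\nu}\Big[\sum_{t=1}^T\max\{0,\,S-\mu_t(a_t)\}\Big].$$ For $\Delta>0$ and $L\in\mathbb N$, let $\mathcal E_{L,\Delta}$ be the set of all environments such that $(\mu_t(1),\mu_t(2))\in\{(S+\Delta,S-\Delta),(S-\Delta,S+\Delta)\}$ for every $t\le T$ and which have exactly $L$ stationary segments, i.e. $1+\#\{1\le j<T:\mu_j\ne\mu_{j+1}\}=L$. There is a universal constant $c>0$ such that for all $S\in\mathbb R$, all $0<\Delta\le\tfrac12$ (which holds in particular whenever the means $S\pm\Delta$ lie in $[0,1]$), and all $T,L\in\mathbb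 N$ with $L\ge 3$ and $\Delta^2T\ge L$, $$\inf_{\pi\in\Pi}\ \sup_{\nu\in\mathcal E_{L,\Delta}} R_T^S(\pi;\nu)\ \ge\ c\,\frac{L\log(\Delta^2T/L)}{\Delta}.$$ -/

import Mathlib

open MeasureTheory ProbabilityTheory
open scoped ENNReal

/-! Nonstationary Gaussian bandits with `K` arms. Rounds are numbered `1, 2, …`. -/

/-- A transcript of the first `t` rounds: entry `i` is the pair (action, reward) of round `i + 1`. -/
abbrev Transcript (K t : ℕ) : Type := Fin t → Fin K × ℝ

/-- A (possibly randomized) policy: for each `t`, a Markov kernel giving the law of the action of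
round `t + 1` conditionally on the actions and rewards of rounds `1, …, t`. -/
structure Policy (K : ℕ) where
  act : ∀ t : ℕ, Kernel (Transcript K t) (Fin K)
  markov : ∀ t : ℕ, IsMarkovKernel (act t)

attribute [instance] Policy.markov

/-- The law of a unit-variance Gaussian reward given the arm, for the vector `m` of arm means. -/
noncomputable def rewardKernel {K : ℕ} (m : Fin K → ℝ) : Kernel (Fin K) ℝ :=
  Kernel.ofFunOfCountable fun a => gaussianReal (m a) 1

instance {K : ℕ} (m : Fin K → ℝ) : IsMarkovKernel (rewardKernel m) :=
  ⟨fun a => inferInstanceAs (IsProbabilityMeasure (gaussianReal (m a) 1))⟩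

/-- The law of the transcript of the first `t` rounds when the policy `π` interacts with the
environment whose arm `a` has mean `μ s a` at round `s`. In round `t + 1` the action is drawn from
the policy given the past; given the past and that action, the reward is a Gaussian with
variance `1` around the current mean of the chosen arm. -/
noncomputable def transcriptLaw {K : ℕ} (π : Policy K) (μ : ℕ → Fin K → ℝ) :
    ∀ t : ℕ, Measure (Transcript K t)
  | 0 => Measure.dirac Fin.elim0
  | t + 1 =>
    (transcriptLaw π μ t ⊗ₘ
        (π.act t ⊗ₖ Kernel.prodMkLeft (Transcript K t) (rewardKernel (μ (t + 1))))).map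
      fun p => (Fin.snoc p.1 p.2 : Transcript K (t + 1))

theorem measurable_transcript_snoc (K t : ℕ) :
    Measurable fun p : Transcript K t × (Fin K × ℝ) =>
      (Fin.snoc p.1 p.2 : Transcript K (t + 1)) := by
  refine measurable_pi_lambda _ fun i => ?_
  induction i using Fin.lastCases with
  | last => simpa only [Fin.snoc_last] using measurable_snd
  | cast j =>
    simp only [Fin.snoc_castSucc]
    exact (measurable_pi_apply j).comp measurable_fst

instance {K : ℕ} (π : Policy K) (μ : ℕ → Fin K → ℝ) (t : ℕ) :
    IsProbabilityMeasure (transcriptLaw π μ t) := by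
  induction t with
  | zero => exact inferInstanceAs (IsProbabilityMeasure (Measure.dirac _))
  | succ t ih =>
    exact Measure.isProbabilityMeasure_map (measurable_transcript_snoc K t).aemeasurable

/-- The satisficing regret `E[∑_{t=1}^T (S - μ_t(a_t))_+]` of the policy `π` over the horizon `T`
in the Gaussian environment with means `μ`, for the threshold `S`. -/
noncomputable def satisficingRegret {K : ℕ} (S : ℝ) (T : ℕ) (π : Policy K)
    (μ : ℕ → Fin K → ℝ) : ℝ≥0∞ :=
  ∫⁻ z, ENNReal.ofReal (∑ i : Fin T, max 0 (S - μ (i + 1) (z i).1)) ∂(transcriptLaw π μ T)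

open scoped Classical in
/-- The number of stationary segments on rounds `1, …, T`: one plus the number of `j` with
`1 ≤ j < T` at which the mean of some arm changes between rounds `j` and `j + 1`. -/
noncomputable def numSegments {K : ℕ} (T : ℕ) (μ : ℕ → Fin K → ℝ) : ℕ :=
  1 + ((Finset.Ico 1 T).filter fun j => ∃ a, μ j a ≠ μ (j + 1) a).card

/-- The class of two-armed environments with exactly `L` stationary segments on rounds `1, …, T`
whose mean vector is always `(S + Δ, S - Δ)` or `(S - Δ, S + Δ)`. (Values of `μ` at other
rounds are irrelevant.) -/
def hardClass (S Δ : ℝ) (T L : ℕ) : Set (ℕ → Fin 2 → ℝ) :=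
  {μ | (∀ t, 1 ≤ t → t ≤ T → μ t = ![S + Δ, S - Δ] ∨ μ t = ![S - Δ, S + Δ]) ∧
    numSegments T μ = L}

/-! Detecting a change requires pulling the currently worse arm, which itself costs regret. If `q`
and `p'` are the probabilities of pulling the second arm in two environments that agree up to round
`s`, a second-moment (chi-square) bound gives `p' ^ 2 ≤ exp (4 * Δ ^ 2 * m) * q` during the next `m`
rounds (`secondArmProb_swapEnv_sq_le`).

Let the first arm be the better one over `M ≥ exp (4 * Δ ^ 2 * m)` windows of length `m`. Either the
second arm gets `m / 4` expected pulls there, all bad, or in some window it gets fewer than `m / (4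
* M)`; making it the better arm in that window then goes largely unnoticed and costs order `m` bad
pulls (`exists_raise_window`).

Such a block uses two changes. By causality blocks can be chained, each chosen after its
predecessors (`exists_blocks`), so about `L / 2` blocks fit into `L` segments. With `m` of order
`log (Δ ^ 2 * T / L) / Δ ^ 2`, or `m = 1` when that is small, they also fit into `T` rounds
(`exists_window_length`), and each costs at least `Δ * m / 4`. -/

/-! ### Second-moment domination of measures -/

/-- `ν` is dominated by `μ` in the second-moment sense: `(∫ f dν)² ≤ E ∫ f² dμ` for `f ≥ 0`. -/
def SqDominated {α : Type*} [MeasurableSpace α] (E : ℝ≥0∞) (μ ν : Measure α) : Prop :=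
  ∀ f : α → ℝ≥0∞, Measurable f → (∫⁻ x, f x ∂ν) ^ 2 ≤ E * ∫⁻ x, f x ^ 2 ∂μ

theorem lintegral_mul_sq_le {α : Type*} [MeasurableSpace α] (μ : Measure α)
    {f g : α → ℝ≥0∞} (hf : Measurable f) (hg : Measurable g) :
    (∫⁻ x, f x * g x ∂μ) ^ 2 ≤ (∫⁻ x, f x ^ 2 ∂μ) * ∫⁻ x, g x ^ 2 ∂μ := by
  have h := ENNReal.lintegral_mul_le_Lp_mul_Lq μ Real.HolderConjugate.two_two
    hf.aemeasurable hg.aemeasurable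
  have h2 := pow_le_pow_left₀ zero_le h 2
  rw [mul_pow] at h2
  simp only [← ENNReal.rpow_natCast, ← ENNReal.rpow_mul] at h2 ⊢
  simpa using h2

namespace SqDominated

variable {α β : Type*} [MeasurableSpace α] [MeasurableSpace β]

theorem refl (μ : Measure α) [IsProbabilityMeasure μ] : SqDominated 1 μ μ := by
  intro f hf
  have h := lintegral_mul_sq_le μ hf (measurable_const (a := (1 : ℝ≥0∞)))
  simpa using h

theorem mono {E E' : ℝ≥0∞} {μ ν : Measure α} (h : SqDominated E μ ν) (hE : E ≤ E') :
    SqDominated E' μ ν := fun f hf => (h f hf).trans (by gcongr)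

theorem map {E : ℝ≥0∞} {μ ν : Measure α} (h : SqDominated E μ ν) {g : α → β}
    (hg : Measurable g) : SqDominated E (μ.map g) (ν.map g) := by
  intro f hf
  rw [lintegral_map hf hg, lintegral_map (hf.pow_const 2) hg]
  exact h _ (hf.comp hg)

/-- The constants multiply: the domination of `ν` is applied to the inner integral against `η`,
whose square is then bounded fibrewise. -/
theorem compProd {E E' : ℝ≥0∞} {μ ν : Measure α} [SFinite μ] [SFinite ν] {κ η : Kernel α β}
    [IsSFiniteKernel κ] [IsSFiniteKernel η] (h : SqDominated E μ ν)
    (h' : ∀ a, SqDominated E' (κ a) (η a)) : SqDominated (E * E') (μ ⊗ₘ κ) (ν ⊗ₘ η) := by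
  intro f hf
  rw [Measure.lintegral_compProd hf, Measure.lintegral_compProd (hf.pow_const 2)]
  refine (h _ hf.lintegral_kernel_prod_right').trans ?_
  rw [mul_assoc, ← lintegral_const_mul _ (hf.pow_const 2).lintegral_kernel_prod_right']
  gcongr with a
  exact h' a _ (hf.comp measurable_prodMk_left)

end SqDominated

/-! ### The chi-square constant of two unit-variance Gaussians -/

/-- Completing the square in the exponent; the right side integrates to `exp ((m' - m) ^ 2)`. -/
theorem gaussianPDF_mul_sq_div (m m' x : ℝ) :
    gaussianPDFReal m' 1 x ^ 2 / gaussianPDFReal m 1 x =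
      Real.exp ((m' - m) ^ 2) * gaussianPDFReal (2 * m' - m) 1 x := by
  rw [div_eq_iff (gaussianPDFReal_pos m 1 x one_ne_zero).ne']
  simp only [gaussianPDFReal]
  generalize (√(2 * Real.pi * ((1 : NNReal) : ℝ)))⁻¹ = c
  have : Real.exp (-(x - m') ^ 2 / (2 * ((1 : NNReal) : ℝ))) ^ 2 =
      Real.exp ((m' - m) ^ 2) * Real.exp (-(x - (2 * m' - m)) ^ 2 / (2 * ((1 : NNReal) : ℝ))) *
        Real.exp (-(x - m) ^ 2 / (2 * ((1 : NNReal) : ℝ))) := by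
    rw [← Real.exp_add, ← Real.exp_add, ← Real.exp_nat_mul]
    congr 1
    push_cast
    ring
  rw [mul_pow, this]
  ring

theorem sqDominated_gaussianReal (m m' : ℝ) :
    SqDominated (ENNReal.ofReal (Real.exp ((m' - m) ^ 2)))
      (gaussianReal m 1) (gaussianReal m' 1) := by
  intro f hf
  have hp : ∀ x, 0 < gaussianPDFReal m 1 x := fun x => gaussianPDFReal_pos m 1 x one_ne_zero
  have hm : Measurable fun x => gaussianPDFReal m 1 x := measurable_gaussianPDFReal m 1
  have hm' : Measurable fun x => gaussianPDFReal m' 1 x := measurable_gaussianPDFReal m' 1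
  rw [gaussianReal_of_var_ne_zero _ one_ne_zero, gaussianReal_of_var_ne_zero _ one_ne_zero,
    lintegral_withDensity_eq_lintegral_mul _ (measurable_gaussianPDF _ _) hf,
    lintegral_withDensity_eq_lintegral_mul _ (measurable_gaussianPDF _ _) (hf.pow_const 2)]
  -- With densities `p`, `p'`, Cauchy–Schwarz is applied to `f * p' = (f * √p) * (p' / √p)`.
  have h := lintegral_mul_sq_le volume
    (f := fun x => f x * ENNReal.ofReal (√(gaussianPDFReal m 1 x)))
    (g := fun x => ENNReal.ofReal (gaussianPDFReal m' 1 x / √(gaussianPDFReal m 1 x)))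
    (by fun_prop) (by fun_prop)
  have e1 : ∀ x, f x * ENNReal.ofReal (√(gaussianPDFReal m 1 x)) *
      ENNReal.ofReal (gaussianPDFReal m' 1 x / √(gaussianPDFReal m 1 x)) =
      (gaussianPDF m' 1 * f) x := fun x => by
    have := (Real.sqrt_pos.2 (hp x)).ne'
    rw [mul_assoc, ← ENNReal.ofReal_mul (Real.sqrt_nonneg _), mul_div_cancel₀ _ this, mul_comm]
    rfl
  have e2 : ∀ x, (f x * ENNReal.ofReal (√(gaussianPDFReal m 1 x))) ^ 2 =
      (gaussianPDF m 1 * fun x => f x ^ 2) x := fun x => by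
    rw [mul_pow, ← ENNReal.ofReal_pow (Real.sqrt_nonneg _), Real.sq_sqrt (hp x).le, mul_comm]
    rfl
  have e3 : ∀ x, ENNReal.ofReal (gaussianPDFReal m' 1 x / √(gaussianPDFReal m 1 x)) ^ 2 =
      ENNReal.ofReal (Real.exp ((m' - m) ^ 2)) * gaussianPDF (2 * m' - m) 1 x := fun x => by
    rw [← ENNReal.ofReal_pow (div_nonneg (gaussianPDFReal_nonneg _ _ _) (Real.sqrt_nonneg _)),
      div_pow, Real.sq_sqrt (hp x).le, gaussianPDF_mul_sq_div,
      ENNReal.ofReal_mul (Real.exp_nonneg _)]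
    rfl
  simp only [e1, e2, e3] at h
  rwa [lintegral_const_mul _ (measurable_gaussianPDF _ _), lintegral_gaussianPDF_eq_one _
    one_ne_zero, mul_one, mul_comm (lintegral _ _)] at h

/-! ### Domination and regret along transcripts -/

section Transcript

variable {K : ℕ}

/-- The joint law of the action and the reward of the next round given the past. -/
noncomputable abbrev roundKernel (π : Policy K) (t : ℕ) (m : Fin K → ℝ) :
    Kernel (Transcript K t) (Fin K × ℝ) :=
  π.act t ⊗ₖ Kernel.prodMkLeft (Transcript K t) (rewardKernel m)

/-- The action law is common to both sides and contributes the factor `1`; only the reward costs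
`exp d`. -/
theorem sqDominated_roundKernel (π : Policy K) (t : ℕ) (m m' : Fin K → ℝ) (d : ℝ)
    (h : ∀ a, (m' a - m a) ^ 2 ≤ d) (z : Transcript K t) :
    SqDominated (ENNReal.ofReal (Real.exp d)) (roundKernel π t m z) (roundKernel π t m' z) := by
  intro f hf
  rw [Kernel.lintegral_compProd _ _ _ hf, Kernel.lintegral_compProd _ _ _ (hf.pow_const 2)]
  refine (SqDominated.refl _ _ (measurable_of_countable _)).trans ?_
  rw [one_mul, ← lintegral_const_mul _ (measurable_of_countable _)]
  refine lintegral_mono fun a => ?_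
  exact ((sqDominated_gaussianReal (m a) (m' a)).mono
    (ENNReal.ofReal_le_ofReal (Real.exp_le_exp.2 (h a)))) _ (hf.comp measurable_prodMk_left)

theorem transcriptLaw_congr (π : Policy K) {μ μ' : ℕ → Fin K → ℝ} {t : ℕ}
    (h : ∀ s, 1 ≤ s → s ≤ t → μ s = μ' s) : transcriptLaw π μ t = transcriptLaw π μ' t := by
  induction t with
  | zero => rfl
  | succ t ih =>
    rw [transcriptLaw, transcriptLaw, ih fun s h1 h2 => h s h1 (h2.trans t.le_succ),
      h (t + 1) (Nat.le_add_left _ _) le_rfl]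

theorem sqDominated_transcriptLaw (π : Policy K) {μ μ' : ℕ → Fin K → ℝ} {s : ℕ} {d : ℝ}
    (h : ∀ t, 1 ≤ t → t ≤ s → μ t = μ' t) (hd : ∀ t a, (μ' t a - μ t a) ^ 2 ≤ d) (n : ℕ) :
    SqDominated (ENNReal.ofReal (Real.exp (n * d)))
      (transcriptLaw π μ (s + n)) (transcriptLaw π μ' (s + n)) := by
  induction n with
  | zero =>
    rw [add_zero, transcriptLaw_congr π h]
    simpa using SqDominated.refl (transcriptLaw π μ' s)
  | succ n ih =>
    have := (ih.compProd (sqDominated_roundKernel π (s + n) (μ (s + n + 1)) (μ' (s + n + 1)) d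
      (hd _))).map (measurable_transcript_snoc K (s + n))
    rw [← ENNReal.ofReal_mul (Real.exp_nonneg _), ← Real.exp_add] at this
    have e : ((n + 1 : ℕ) : ℝ) * d = n * d + d := by push_cast; ring
    rw [e]
    exact this

theorem lintegral_transcriptLaw_init (π : Policy K) (μ : ℕ → Fin K → ℝ) (t : ℕ)
    {f : Transcript K t → ℝ≥0∞} (hf : Measurable f) :
    ∫⁻ z, f (Fin.init z) ∂(transcriptLaw π μ (t + 1)) = ∫⁻ z, f z ∂(transcriptLaw π μ t) := by
  have hi : Measurable fun z : Transcript K (t + 1) => f (Fin.init z) :=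
    hf.comp (measurable_pi_lambda _ fun i => measurable_pi_apply _)
  rw [transcriptLaw, lintegral_map hi (measurable_transcript_snoc K t)]
  simp only [Fin.init_snoc]
  rw [Measure.lintegral_compProd (f := fun p => f p.1) (hf.comp measurable_fst)]
  simp

theorem measurable_regret_term (f : Fin K → ℝ) {t : ℕ} (i : Fin t) :
    Measurable fun z : Transcript K t => f (z i).1 :=
  (measurable_of_countable f).comp (measurable_fst.comp (measurable_pi_apply i))

theorem satisficingRegret_succ (S : ℝ) (T : ℕ) (π : Policy K) (μ : ℕ → Fin K → ℝ) :
    satisficingRegret S (T + 1) π μ = satisficingRegret S T π μ +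
      ∫⁻ z, ENNReal.ofReal (max 0 (S - μ (T + 1) (z (Fin.last T)).1))
        ∂(transcriptLaw π μ (T + 1)) := by
  have hm : ∀ (t : ℕ) (i : Fin t) (s : ℕ),
      Measurable fun z : Transcript K t => max 0 (S - μ s (z i).1) := fun t i s =>
    measurable_regret_term (fun a => max 0 (S - μ s a)) i
  have hs : Measurable fun z : Transcript K T =>
      ENNReal.ofReal (∑ i : Fin T, max 0 (S - μ (i + 1) (z i).1)) :=
    (Finset.measurable_sum _ fun i _ => hm T i _).ennreal_ofReal
  rw [satisficingRegret, satisficingRegret, ← lintegral_transcriptLaw_init π μ T hs,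
    ← lintegral_add_right _ (hm _ _ _).ennreal_ofReal]
  refine lintegral_congr fun z => ?_
  rw [← ENNReal.ofReal_add (Finset.sum_nonneg fun _ _ => le_max_left _ _) (le_max_left _ _),
    Fin.sum_univ_castSucc]
  rfl

end Transcript

/-! ### Regret of two-armed swap environments -/

/-- The environment in which the arm with mean `S + Δ` at round `t` is the second one if `b t`
and the first one otherwise. -/
noncomputable def swapEnv (S Δ : ℝ) (b : ℕ → Bool) (t : ℕ) : Fin 2 → ℝ :=
  if b t then ![S - Δ, S + Δ] else ![S + Δ, S - Δ]

/-- The probability that the second arm is pulled at round `t + 1`. -/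
noncomputable def secondArmProb (π : Policy 2) (μ : ℕ → Fin 2 → ℝ) (t : ℕ) : ℝ :=
  (transcriptLaw π μ (t + 1)).real {z | (z (Fin.last t)).1 = 1}

theorem measurableSet_secondArm (t : ℕ) :
    MeasurableSet {z : Transcript 2 (t + 1) | (z (Fin.last t)).1 = 1} :=
  (measurable_fst.comp (measurable_pi_apply (Fin.last t))) (measurableSet_singleton 1)

theorem secondArmProb_nonneg (π : Policy 2) (μ : ℕ → Fin 2 → ℝ) (t : ℕ) :
    0 ≤ secondArmProb π μ t := measureReal_nonneg

theorem secondArmProb_le_one (π : Policy 2) (μ : ℕ → Fin 2 → ℝ) (t : ℕ) :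
    secondArmProb π μ t ≤ 1 := measureReal_le_one

theorem secondArmProb_swapEnv_congr (π : Policy 2) (S Δ : ℝ) {b b' : ℕ → Bool} {t : ℕ}
    (h : ∀ s ≤ t + 1, b s = b' s) :
    secondArmProb π (swapEnv S Δ b) t = secondArmProb π (swapEnv S Δ b') t := by
  rw [secondArmProb, secondArmProb,
    transcriptLaw_congr π (μ' := swapEnv S Δ b') fun s _ hs => by simp only [swapEnv, h s hs]]

theorem secondArmProb_swapEnv_sq_le (π : Policy 2) (S Δ : ℝ) {b b' : ℕ → Bool} {s t m : ℕ}
    (h : ∀ u ≤ s, b u = b' u) (hst : s ≤ t) (htm : t < s + m) :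
    secondArmProb π (swapEnv S Δ b') t ^ 2 ≤
      Real.exp (4 * Δ ^ 2 * m) * secondArmProb π (swapEnv S Δ b) t := by
  have hd : ∀ t a, (swapEnv S Δ b' t a - swapEnv S Δ b t a) ^ 2 ≤ 4 * Δ ^ 2 := by
    intro t a
    have := sq_nonneg Δ
    cases hb : b t <;> cases hb' : b' t <;> fin_cases a <;> simp [swapEnv, hb, hb'] <;> nlinarith
  obtain ⟨n, hn⟩ : ∃ n, t + 1 = s + n := ⟨t + 1 - s, by omega⟩
  have key := sqDominated_transcriptLaw π
    (fun u _ hu => by simp only [swapEnv, h u hu] : ∀ u, 1 ≤ u → u ≤ s →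
      swapEnv S Δ b u = swapEnv S Δ b' u) hd n
  rw [← hn] at key
  have hA := measurableSet_secondArm t
  -- An indicator equals its square, so domination compares the probabilities of the event directly.
  have h1 := key _ ((measurable_one (α := ℝ≥0∞)).indicator hA)
  have e : ∀ z, (Set.indicator {z : Transcript 2 (t + 1) | (z (Fin.last t)).1 = 1}
      (1 : Transcript 2 (t + 1) → ℝ≥0∞) z) ^ 2 =
      Set.indicator {z : Transcript 2 (t + 1) | (z (Fin.last t)).1 = 1} 1 z := by
    intro z
    by_cases hz : z ∈ {z : Transcript 2 (t + 1) | (z (Fin.last t)).1 = 1} <;> simp [hz]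
  simp only [e, lintegral_indicator_one hA] at h1
  have h2 := ENNReal.toReal_mono
    (ENNReal.mul_ne_top ENNReal.ofReal_ne_top (measure_ne_top _ _)) h1
  rw [ENNReal.toReal_pow, ENNReal.toReal_mul, ENNReal.toReal_ofReal (Real.exp_nonneg _)] at h2
  refine h2.trans (mul_le_mul_of_nonneg_right (Real.exp_le_exp.2 ?_) ENNReal.toReal_nonneg)
  have : (n : ℝ) ≤ m := by exact_mod_cast (by omega : n ≤ m)
  nlinarith [sq_nonneg Δ]

/-- The probability of pulling the worse arm of `swapEnv S Δ b` at round `t + 1`. -/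
noncomputable def badArmProb (π : Policy 2) (S Δ : ℝ) (b : ℕ → Bool) (t : ℕ) : ℝ :=
  if b (t + 1) then 1 - secondArmProb π (swapEnv S Δ b) t else secondArmProb π (swapEnv S Δ b) t

theorem badArmProb_nonneg (π : Policy 2) (S Δ : ℝ) (b : ℕ → Bool) (t : ℕ) :
    0 ≤ badArmProb π S Δ b t := by
  unfold badArmProb
  split_ifs
  · exact sub_nonneg.2 (secondArmProb_le_one _ _ _)
  · exact secondArmProb_nonneg _ _ _

theorem badArmProb_congr (π : Policy 2) (S Δ : ℝ) {b b' : ℕ → Bool} {t : ℕ}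
    (h : ∀ s ≤ t + 1, b s = b' s) : badArmProb π S Δ b t = badArmProb π S Δ b' t := by
  rw [badArmProb, badArmProb, secondArmProb_swapEnv_congr π S Δ h, h _ le_rfl]

theorem lintegral_regret_swapEnv (π : Policy 2) (S : ℝ) {Δ : ℝ} (hΔ : 0 < Δ) (b : ℕ → Bool)
    (t : ℕ) :
    ∫⁻ z, ENNReal.ofReal (max 0 (S - swapEnv S Δ b (t + 1) (z (Fin.last t)).1))
        ∂(transcriptLaw π (swapEnv S Δ b) (t + 1)) =
      ENNReal.ofReal (Δ * badArmProb π S Δ b t) := by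
  have hA := measurableSet_secondArm t
  rw [ENNReal.ofReal_mul hΔ.le, badArmProb]
  cases hb : b (t + 1)
  · have e : ∀ z : Transcript 2 (t + 1),
        ENNReal.ofReal (max 0 (S - swapEnv S Δ b (t + 1) (z (Fin.last t)).1)) =
          Set.indicator {z : Transcript 2 (t + 1) | (z (Fin.last t)).1 = 1}
            (fun _ => ENNReal.ofReal Δ) z := by
      intro z
      have hz : (z (Fin.last t)).1 = 0 ∨ (z (Fin.last t)).1 = 1 := by omega
      rcases hz with hz | hz <;> simp [swapEnv, hb, hz, hΔ.le]
    simp only [e, lintegral_indicator_const hA]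
    simp [secondArmProb]
  · have e : ∀ z : Transcript 2 (t + 1),
        ENNReal.ofReal (max 0 (S - swapEnv S Δ b (t + 1) (z (Fin.last t)).1)) =
          Set.indicator {z : Transcript 2 (t + 1) | (z (Fin.last t)).1 = 1}ᶜ
            (fun _ => ENNReal.ofReal Δ) z := by
      intro z
      have hz : (z (Fin.last t)).1 = 0 ∨ (z (Fin.last t)).1 = 1 := by omega
      rcases hz with hz | hz <;> simp [swapEnv, hb, hz, hΔ.le]
    simp only [e, lintegral_indicator_const hA.compl, if_true, secondArmProb]
    rw [← probReal_compl_eq_one_sub hA, ofReal_measureReal]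

theorem satisficingRegret_swapEnv (π : Policy 2) (S : ℝ) {Δ : ℝ} (hΔ : 0 < Δ) (b : ℕ → Bool)
    (T : ℕ) :
    satisficingRegret S T π (swapEnv S Δ b) =
      ENNReal.ofReal (Δ * ∑ t ∈ Finset.range T, badArmProb π S Δ b t) := by
  induction T with
  | zero => simp [satisficingRegret]
  | succ T ih =>
    rw [satisficingRegret_succ, ih, lintegral_regret_swapEnv π S hΔ, ← ENNReal.ofReal_add
      (mul_nonneg hΔ.le (Finset.sum_nonneg fun _ _ => badArmProb_nonneg _ _ _ _ _))
      (mul_nonneg hΔ.le (badArmProb_nonneg _ _ _ _ _)), Finset.sum_range_succ, mul_add]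

/-! ### One block: hiding a switch in a window -/

/-- Switch `b` to `true` on `(s, s + m]`. -/
def raise (b : ℕ → Bool) (s m : ℕ) (t : ℕ) : Bool := b t || decide (s < t ∧ t ≤ s + m)

theorem raise_of_le (b : ℕ → Bool) {s m t : ℕ} (h : t ≤ s) : b t = raise b s m t := by
  simp [raise, h.not_gt]

theorem sum_Ico_windows (q : ℕ → ℝ) (a m M : ℕ) :
    ∑ w ∈ Finset.range M, ∑ t ∈ Finset.Ico (a + w * m) (a + w * m + m), q t =
      ∑ t ∈ Finset.Ico a (a + M * m), q t := by
  induction M with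
  | zero => simp
  | succ M ih =>
    rw [Finset.sum_range_succ, ih, Finset.sum_Ico_consecutive _ (by omega) (by omega)]
    congr 2
    ring

/-- If the first arm is better after round `a`, then some window of length `m` can be chosen such
that making the second arm better there forces `m / 4` bad pulls in expectation after round `a`:
either the policy already pulls the second arm too often before the last window, or it pulls it so
rarely in some window that it cannot react to the switch. -/
theorem exists_raise_window (π : Policy 2) (S Δ : ℝ) (b : ℕ → Bool) {a m M : ℕ} (hm : 0 < m)
    (hM : Real.exp (4 * Δ ^ 2 * m) ≤ M) (hb : ∀ t, a < t → b t = false) :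
    ∃ s, a < s ∧ s + m ≤ a + ((M + 1) * m + 1) ∧
      (m : ℝ) / 4 ≤ ∑ t ∈ Finset.Ico a (s + m), badArmProb π S Δ (raise b s m) t := by
  have hM0 : (0 : ℝ) < M := (Real.exp_pos _).trans_le hM
  have hm0 : (0 : ℝ) < m := by exact_mod_cast hm
  set q := secondArmProb π (swapEnv S Δ b) with hq
  by_cases hc : (m : ℝ) / 4 ≤ ∑ t ∈ Finset.Ico (a + 1) (a + 1 + M * m), q t
  · refine ⟨a + 1 + M * m, by omega, by linarith [add_mul M 1 m], hc.trans ?_⟩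
    have : ∑ t ∈ Finset.Ico (a + 1) (a + 1 + M * m), q t =
        ∑ t ∈ Finset.Ico (a + 1) (a + 1 + M * m),
          badArmProb π S Δ (raise b (a + 1 + M * m) m) t := by
      refine Finset.sum_congr rfl fun t ht => ?_
      rw [Finset.mem_Ico] at ht
      rw [← badArmProb_congr π S Δ fun s hs => raise_of_le b (by omega), badArmProb,
        hb _ (by omega)]
      simp [hq]
    rw [this]
    exact Finset.sum_le_sum_of_subset_of_nonneg (Finset.Ico_subset_Ico (by omega) (by omega))
      fun t _ _ => badArmProb_nonneg _ _ _ _ _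
  · rw [not_le, ← sum_Ico_windows] at hc
    obtain ⟨w, hw, hlt⟩ : ∃ w ∈ Finset.range M,
        ∑ t ∈ Finset.Ico (a + 1 + w * m) (a + 1 + w * m + m), q t < m / (4 * M) := by
      apply Finset.exists_lt_of_sum_lt
      rw [Finset.sum_const, Finset.card_range, nsmul_eq_mul]
      refine hc.trans_eq ?_
      field_simp
    rw [Finset.mem_range] at hw
    have hwM : w * m ≤ M * m := Nat.mul_le_mul_right m hw.le
    refine ⟨a + 1 + w * m, by omega, by linarith [add_mul M 1 m], ?_⟩
    set s := a + 1 + w * m with hs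
    calc (m : ℝ) / 4 ≤ m / 2 - M / 2 * (m / (4 * M)) := by
          have : (M : ℝ) / 2 * (m / (4 * M)) = m / 8 := by field_simp; norm_num
          rw [this]; linarith
      _ ≤ m / 2 - M / 2 * ∑ t ∈ Finset.Ico s (s + m), q t := by gcongr
      _ = ∑ t ∈ Finset.Ico s (s + m), (1 / 2 - M / 2 * q t) := by
          rw [Finset.sum_sub_distrib, Finset.mul_sum]
          simp [div_eq_mul_inv]
      _ ≤ ∑ t ∈ Finset.Ico s (s + m), badArmProb π S Δ (raise b s m) t := by
          refine Finset.sum_le_sum fun t ht => ?_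
          rw [Finset.mem_Ico] at ht
          have h1 := secondArmProb_swapEnv_sq_le π S Δ
            (fun u hu => raise_of_le b hu : ∀ u ≤ s, b u = raise b s m u) ht.1 ht.2
          have h2 : raise b s m (t + 1) = true := by
            simp only [raise, Bool.or_eq_true, decide_eq_true_eq]
            omega
          have h3 := mul_le_mul_of_nonneg_right hM (secondArmProb_nonneg π (swapEnv S Δ b) t)
          rw [badArmProb, if_pos h2]
          -- `1 - p' ≥ (1 - p' ^ 2) / 2`, and `p' ^ 2 ≤ M * q`.
          nlinarith [sq_nonneg (secondArmProb π (swapEnv S Δ (raise b s m)) t - 1)]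
      _ ≤ _ := Finset.sum_le_sum_of_subset_of_nonneg
          (Finset.Ico_subset_Ico (by omega) le_rfl) fun t _ _ => badArmProb_nonneg _ _ _ _ _

/-! ### Counting changes and chaining blocks -/

/-- The times `1 ≤ j < T` at which `b` changes between `j` and `j + 1`. -/
def changes (b : ℕ → Bool) (T : ℕ) : Finset ℕ := {j ∈ Finset.Ico 1 T | b j ≠ b (j + 1)}

theorem numSegments_swapEnv (S : ℝ) {Δ : ℝ} (hΔ : 0 < Δ) (b : ℕ → Bool) (T : ℕ) :
    numSegments T (swapEnv S Δ b) = 1 + (changes b T).card := by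
  rw [numSegments, changes]
  congr 2
  refine Finset.filter_congr fun j _ => ?_
  have : S - Δ ≠ S + Δ := by linarith
  cases hj : b j <;> cases hj' : b (j + 1) <;> simp [swapEnv, hj, hj', Fin.exists_fin_two, this.symm]

theorem swapEnv_mem_hardClass (S : ℝ) {Δ : ℝ} (hΔ : 0 < Δ) {b : ℕ → Bool} {T L : ℕ}
    (h : 1 + (changes b T).card = L) : swapEnv S Δ b ∈ hardClass S Δ T L := by
  refine ⟨fun t _ _ => ?_, (numSegments_swapEnv S hΔ b T).trans h⟩
  cases hb : b t <;> simp [swapEnv, hb]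

theorem changes_raise {b : ℕ → Bool} {a s m T : ℕ} (hm : 0 < m)
    (hb : ∀ t, a < t → b t = false) (hs : a < s) (hT : s + m < T) :
    changes (raise b s m) T = insert s (insert (s + m) (changes b T)) := by
  ext j
  simp only [changes, Finset.mem_filter, Finset.mem_insert, Finset.mem_Ico]
  rcases le_or_gt j a with hj | hj
  · rw [← raise_of_le b (by omega), ← raise_of_le b (by omega)]
    simp [show j ≠ s by omega, show j ≠ s + m by omega]
  · simp only [raise, hb j hj, hb (j + 1) (by omega), Bool.false_or, ne_eq, decide_eq_decide]
    simp only [not_true_eq_false, and_false, or_false]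
    omega

/-- All old changes are at most `a`, so `a < s` keeps the two new ones distinct from them. The extra
round in the block length `(M + 1) * m + 1` secures this. -/
theorem card_changes_raise {b : ℕ → Bool} {a s m T : ℕ} (hm : 0 < m)
    (hb : ∀ t, a < t → b t = false) (hs : a < s) (hT : s + m < T) :
    (changes (raise b s m) T).card = (changes b T).card + 2 := by
  have h : ∀ j, a < j → j ∉ changes b T := fun j hj => by
    simp [changes, hb j hj, hb (j + 1) (by omega)]
  rw [changes_raise hm hb hs hT, Finset.card_insert_of_notMem, Finset.card_insert_of_notMem
    (h _ (by omega))]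
  rw [Finset.mem_insert, not_or]
  exact ⟨by omega, h s hs⟩

theorem exists_blocks (π : Policy 2) (S Δ : ℝ) {m M : ℕ} (hm : 0 < m)
    (hM : Real.exp (4 * Δ ^ 2 * m) ≤ M) (K : ℕ) {T : ℕ} (hT : K * ((M + 1) * m + 1) < T) :
    ∃ b : ℕ → Bool, (∀ t, K * ((M + 1) * m + 1) < t → b t = false) ∧
      (changes b T).card = 2 * K ∧
      (K : ℝ) * (m / 4) ≤
        ∑ t ∈ Finset.range (K * ((M + 1) * m + 1)), badArmProb π S Δ b t := by
  induction K with
  | zero => exact ⟨fun _ => false, by simp, by simp [changes], by simp⟩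
  | succ K ih =>
    generalize hB : (M + 1) * m + 1 = B at *
    rw [add_mul K, one_mul] at hT ⊢
    obtain ⟨b, hb, hcard, hsum⟩ := ih (by omega)
    obtain ⟨s, has, hsB, hs⟩ := exists_raise_window π S Δ b hm hM hb
    rw [hB] at hsB
    refine ⟨raise b s m, fun t ht => ?_, ?_, ?_⟩
    · simp only [raise, hb t (by omega), Bool.false_or, decide_eq_false_iff_not]
      omega
    · rw [card_changes_raise hm hb has (by omega), hcard]
      ring
    · rw [← Finset.sum_range_add_sum_Ico _ (Nat.le_add_right (K * B) B)]
      have h1 : ∑ t ∈ Finset.range (K * B), badArmProb π S Δ b t =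
          ∑ t ∈ Finset.range (K * B), badArmProb π S Δ (raise b s m) t := by
        refine Finset.sum_congr rfl fun t ht => badArmProb_congr π S Δ fun u hu =>
          raise_of_le b ?_
        rw [Finset.mem_range] at ht
        omega
      have h2 := hs.trans (Finset.sum_le_sum_of_subset_of_nonneg
        (Finset.Ico_subset_Ico le_rfl hsB) fun t _ _ => badArmProb_nonneg π S Δ _ t)
      rw [← h1]
      push_cast
      linarith

theorem exists_mem_hardClass_le_regret (π : Policy 2) (S : ℝ) {Δ : ℝ} (hΔ : 0 < Δ) {m M K : ℕ}
    (hm : 0 < m) (hM : Real.exp (4 * Δ ^ 2 * m) ≤ M) {T L : ℕ}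
    (hT : K * ((M + 1) * m + 1) + 2 ≤ T) (hL : L = 2 * K + 1 ∨ L = 2 * K + 2) :
    ∃ μ ∈ hardClass S Δ T L,
      ENNReal.ofReal (Δ * (K * (m / 4))) ≤ satisficingRegret S T π μ := by
  obtain ⟨b, hb, hcard, hsum⟩ := exists_blocks π S Δ hm hM K (T := T) (by omega)
  generalize K * ((M + 1) * m + 1) = N at *
  have key : ∀ b' : ℕ → Bool, (∀ t < T, b t = b' t) →
      ENNReal.ofReal (Δ * (K * (m / 4))) ≤ satisficingRegret S T π (swapEnv S Δ b') := by
    intro b' hbb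
    rw [satisficingRegret_swapEnv π S hΔ]
    refine ENNReal.ofReal_le_ofReal (mul_le_mul_of_nonneg_left (hsum.trans ?_) hΔ.le)
    have h1 : ∑ t ∈ Finset.range N, badArmProb π S Δ b t =
        ∑ t ∈ Finset.range N, badArmProb π S Δ b' t := by
      refine Finset.sum_congr rfl fun t ht => badArmProb_congr π S Δ fun u hu => hbb u ?_
      rw [Finset.mem_range] at ht
      omega
    rw [h1]
    exact Finset.sum_le_sum_of_subset_of_nonneg (Finset.range_mono (by omega))
      fun t _ _ => badArmProb_nonneg _ _ _ _ _
  rcases hL with hL | hL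
  · exact ⟨_, swapEnv_mem_hardClass S hΔ (by omega), key b fun _ _ => rfl⟩
  -- For even `L` the missing change is put at `T - 1`: it alters only round `T`, after all counted
  -- bad pulls.
  · refine ⟨_, swapEnv_mem_hardClass S hΔ (b := raise b (T - 1) 1) ?_,
      key _ fun t ht => raise_of_le b (by omega)⟩
    have h : changes (raise b (T - 1) 1) T = insert (T - 1) (changes b T) := by
      ext j
      simp only [changes, Finset.mem_filter, Finset.mem_insert, Finset.mem_Ico]
      rcases lt_or_ge j (T - 1) with hj | hj
      · rw [← raise_of_le b (by omega), ← raise_of_le b (by omega)]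
        simp [show j ≠ T - 1 by omega]
      · simp only [raise, hb j (by omega), hb (j + 1) (by omega), Bool.false_or, ne_eq,
          decide_eq_decide]
        omega
    rw [h, Finset.card_insert_of_notMem, hcard, hL]
    · ring
    · simp [changes, hb (T - 1) (by omega), hb (T - 1 + 1) (by omega)]

/-! ### Choice of parameters and conclusion -/

/-- The window length is at least `log x / (16 Δ²)`, while `exp (4 Δ² m) + 3` windows of this
length fit into a bit less than `2 x / Δ²` rounds. -/
theorem exists_window_length {Δ x : ℝ} (hΔ : 0 < Δ) (hΔ' : Δ ≤ 1 / 2) (hx : 1 ≤ x) :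
    ∃ m : ℕ, 0 < m ∧ Real.log x / (16 * Δ ^ 2) ≤ m ∧
      (Real.exp (4 * Δ ^ 2 * m) + 3) * (Δ ^ 2 * m) ≤ 3 / 2 * x := by
  have hD : 0 < Δ ^ 2 := by positivity
  have hD4 : Δ ^ 2 ≤ 1 / 4 := by nlinarith
  have hlog : 0 ≤ Real.log x := Real.log_nonneg hx
  set y := Real.log x / (8 * Δ ^ 2) with hy
  have hy0 : 0 ≤ y := by positivity
  have hy2 : Real.log x / (16 * Δ ^ 2) = y / 2 := by rw [hy]; ring
  rw [hy2]
  rcases lt_or_ge y 1 with h1 | h1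
  -- Here `Δ ≤ 1 / 2` gives `4 * Δ ^ 2 ≤ 1`, and `(e + 3) / 4 < 3 / 2`.
  · refine ⟨1, one_pos, by push_cast; linarith, ?_⟩
    have he : Real.exp (4 * Δ ^ 2 * ((1 : ℕ) : ℝ)) ≤ 2.7182818286 := by
      refine le_trans (Real.exp_le_exp.2 ?_) Real.exp_one_lt_d9.le
      push_cast
      linarith
    push_cast at he ⊢
    nlinarith
  · refine ⟨⌊y⌋₊, Nat.floor_pos.2 h1, ?_, ?_⟩
    · have h2 : (1 : ℝ) ≤ ⌊y⌋₊ := by exact_mod_cast Nat.floor_pos.2 h1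
      linarith [Nat.lt_floor_add_one y]
    · have hu : Δ ^ 2 * ⌊y⌋₊ ≤ Real.log x / 8 := by
        calc Δ ^ 2 * ⌊y⌋₊ ≤ Δ ^ 2 * y := by gcongr; exact Nat.floor_le hy0
          _ = Real.log x / 8 := by rw [hy]; field_simp
      have hz := Real.exp_pos (Real.log x / 2)
      have hz2 : Real.exp (Real.log x / 2) ^ 2 = x := by
        rw [← Real.exp_nat_mul, Nat.cast_ofNat, mul_div_cancel₀ _ two_ne_zero,
          Real.exp_log (by linarith)]
      -- This choice of `y` keeps the exponential below `√x`, leaving room for the logarithmic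
      -- factor.
      have he : Real.exp (4 * Δ ^ 2 * ⌊y⌋₊) ≤ Real.exp (Real.log x / 2) :=
        Real.exp_le_exp.2 (by linarith)
      have hl := Real.add_one_le_exp (Real.log x / 2)
      have hz1 : 1 ≤ Real.exp (Real.log x / 2) := Real.one_le_exp (by positivity)
      calc _ ≤ (Real.exp (Real.log x / 2) + 3) * (Real.log x / 8) := by gcongr
        _ ≤ 3 / 2 * x := by
          generalize Real.exp (Real.log x / 2) = z at *
          generalize Real.log x = l at *
          rw [← hz2]
          nlinarith

theorem theorem1 :
    ∃ c : ℝ, 0 < c ∧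
      ∀ (S Δ : ℝ) (T L : ℕ), 0 < Δ → Δ ≤ 1 / 2 → 3 ≤ L → (L : ℝ) ≤ Δ ^ 2 * T →
        ENNReal.ofReal (c * (L * Real.log (Δ ^ 2 * T / L) / Δ)) ≤
          ⨅ π : Policy 2, ⨆ μ ∈ hardClass S Δ T L, satisficingRegret S T π μ := by
  -- `1 / 256 = 1 / 4 * 1 / 16 * 1 / 4`, from `L ≤ 4 * K`, the lower bound on `m` and the `m / 4`
  -- bad pulls per block.
  refine ⟨1 / 256, by norm_num, fun S Δ T L hΔ hΔ' hL hT => le_iInf fun π => ?_⟩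
  have hD : 0 < Δ ^ 2 := by positivity
  have hL3 : (3 : ℝ) ≤ L := by exact_mod_cast hL
  have hL0 : (0 : ℝ) < L := by linarith
  set x := Δ ^ 2 * T / L with hx
  have hx1 : 1 ≤ x := (one_le_div hL0).2 hT
  have hxL : x * L = Δ ^ 2 * T := div_mul_cancel₀ _ hL0.ne'
  have hlog : 0 ≤ Real.log x := Real.log_nonneg hx1
  obtain ⟨m, hm, hlm, hmx⟩ := exists_window_length hΔ hΔ' hx1
  obtain ⟨K, hK⟩ : ∃ K, L = 2 * K + 1 ∨ L = 2 * K + 2 := ⟨(L - 1) / 2, by omega⟩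
  have hm1 : (1 : ℝ) ≤ m := by exact_mod_cast hm
  have hK1 : (L : ℝ) ≤ 4 * K := by exact_mod_cast (by omega : L ≤ 4 * K)
  have hK2 : 2 * (K : ℝ) + 1 ≤ L := by exact_mod_cast (by omega : 2 * K + 1 ≤ L)
  set E := Real.exp (4 * Δ ^ 2 * m) with hE
  have hM : (⌈E⌉₊ : ℝ) < E + 1 := Nat.ceil_lt_add_one (Real.exp_pos _).le
  have hfit : K * ((⌈E⌉₊ + 1) * m + 1) + 2 ≤ T := by
    have h1 : ((⌈E⌉₊ : ℝ) + 1) * m + 1 ≤ (E + 3) * m := by nlinarith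
    have h2 : Δ ^ 2 * (K * (((⌈E⌉₊ : ℝ) + 1) * m + 1) + 2) ≤ Δ ^ 2 * T := by
      calc Δ ^ 2 * (K * (((⌈E⌉₊ : ℝ) + 1) * m + 1) + 2)
          ≤ Δ ^ 2 * (K * ((E + 3) * m) + 2) := by gcongr
        _ = K * ((E + 3) * (Δ ^ 2 * m)) + 2 * Δ ^ 2 := by ring
        _ ≤ K * (3 / 2 * x) + 2 * Δ ^ 2 := by gcongr
        _ ≤ x * L := by nlinarith
        _ = Δ ^ 2 * T := hxL
    exact_mod_cast le_of_mul_le_mul_left h2 hD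
  obtain ⟨μ, hμ, hreg⟩ := exists_mem_hardClass_le_regret π S hΔ hm (Nat.le_ceil E) hfit hK
  refine le_iSup₂_of_le μ hμ (le_trans (ENNReal.ofReal_le_ofReal ?_) hreg)
  calc 1 / 256 * (L * Real.log x / Δ)
      = Δ * (L / 4 * (Real.log x / (16 * Δ ^ 2) / 4)) 
        := by field_simp; ring
    _ ≤ Δ * (K * (m / 4)) := by
        have : 0 ≤ Real.log x / (16 * Δ ^ 2) := by positivity
        gcongr
        linarith
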